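/- **Model.** Let $G=(V,E)$ be a directed multigraph with finitely many edges, with a source $s$ and a sink $t\neq s$. Each edge $e$ has a transit time $\tau_e\ge 0$, a capacity $\nu_e>0$ and a cost $c_e\ge 0$. There are a constant inflow rate $u>0$ and a deadline $D>0$. Let $\mathcal P$ be the set of simple $s,t$-paths. $G$ is a *parallel path network* if distinct paths in $\mathcal P$ have no edge in common. A *flow over time* $f$ consists of non-negative, locally integrable path inflow rates $(f_P^+)_{P\in\mathcal P}$ and edge inflow rates $(f_e^+)_{e\in E}$ on $[0,\infty)$ (understood up to null sets) with the following properties. The queue mass $z_e$ of $e$ satisfies $z_e(0)=0$ and, almost everywhere, $z_e'=f_e^+-\nu_e$ where $z_e>0$ and $z_e'=\max\{f_e^+-\nu_e,0\}$ where $z_e=0$. A particle that enters $e$ at time $\theta$ leaves it at time $T_e(\theta)=\theta+z_e(\theta)/\nu_e+\tau_e$. The outflow rate is $f_e^-(\theta+\tau_e)=\nu_e$ if $z_e(\theta)>0$, and $\min\{f_e^+(\theta),\nu_e\}$ if $z_e(\theta)=0$ (and $f_e^-=0$ on $[0,\tau_e)$). For every $v\ne t$ and almost every $\theta\ge0$,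 $\sum_{e\in\delta^+(v)}f_e^+(\theta)-\sum_{e\in\delta^-(v)}f_e^-(\theta)$ equals $u$ if $v=s$ and $0$ otherwise. Writing $\ell_v^P(\theta)$ for the time at which the particle that leaves $s$ at time $\theta$ along $P$ arrives at $v$ (so $\ell^P_s(\theta)=\theta$ and $\ell^P_w(\theta)=T_{e}(\ell^P_v(\theta))$ for an edge $e=(v,w)$ of $P$), the path rates induce the edge rates: for every edge $e$ with tail $v$ and all $\theta\ge 0$, $$\int_0^\theta f_e^+(\xi)\,d\xi=\sum_{P\ni e}\ \int_{\{\xi\ge 0:\ \ell_v^P(\xi)\le\theta\}}f_P^+(\xi)\,d\xi .$$ The cost $c_P(\theta)$ of particle $\theta$ along $P$ is $\sum_{e\in P}c_e$ if $\ell_t^P(\theta)<D$, and $\infty$ otherwise. $f$ is a *Nash flow* if, for almost every $\theta\ge0$, $f_P^+(\theta)>0$ implies $c_P(\theta)=\min_{Q\in\mathcal P}c_Q(\theta)$. The throughput of $f$ is the amount of flow that arrives at $t$ before the deadline, $M_f=\sum_{P}\int_{\{\theta\ge0:\ \ell_t^P(\theta)<D\}}f_P^+(\theta)\,d\theta$.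 With $M^*=\sup_f M_f$ over all flows over time, the *throughput-price of anarchy* of the instance is $\sup M^*/M_f$ over all Nash flows $f$. **Theorem.** In every parallel path network with $\tau_e=0$ for all $e\in E$, the throughput-price of anarchy is at most $\frac{\mathrm e}{\mathrm e-1}$. This bound is asymptotically tight: for the network that consists of $k$ parallel edges from $s$ to $t$, each with capacity $1/k$ and transit time $0$, with arbitrary non-negative edge costs and $u=D=1$, the throughput-price of anarchy tends to $\frac{\mathrm e}{\mathrm e-1}$ as $k\to\infty$. -/

import Mathlib

open MeasureTheory Filter Topology
open scoped NNReal ENNReal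

/-- An instance of the model: a directed multigraph with vertices `V` and edges `E`, a source, a
sink, a constant network inflow rate `u > 0`, a deadline `D`, and for every edge a transit time
`τ ≥ 0`, a capacity `ν > 0` and a cost `c ≥ 0`. -/
structure Network (V E : Type*) where
  src : E → V
  tgt : E → V
  source : V
  sink : V
  source_ne_sink : source ≠ sink
  transit : E → ℝ≥0
  capacity : E → ℝ
  capacity_pos : ∀ e, 0 < capacity e
  cost : E → ℝ≥0
  inflow : ℝ
  inflow_pos : 0 < inflow
  deadline : ℝ
  deadline_pos : 0 < deadline

namespace Network

variable {V E : Type*}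

/-- The edge list `p` is a directed walk from `a` to `b`. -/
def IsWalk (N : Network V E) : V → List E → V → Prop
  | a, [], b => a = b
  | a, e :: p, b => N.src e = a ∧ N.IsWalk (N.tgt e) p b

/-- The edge list `p` is an `s`,`t`-path: a walk from the source to the sink that visits no vertex
twice. -/
def IsPath (N : Network V E) (p : List E) : Prop :=
  N.IsWalk N.source p N.sink ∧ (N.source :: p.map N.tgt).Nodup

/-- The set of all `s`,`t`-paths. -/
def Path (N : Network V E) : Type _ := {p : List E // N.IsPath p}

/-- The list of edges of a path, in the order of traversal. -/
def Path.edges {N : Network V E} (P : N.Path) : List E := P.1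

theorem Path.nodup_edges {N : Network V E} (P : N.Path) : P.edges.Nodup :=
  List.Nodup.of_map N.tgt (List.nodup_cons.mp P.2.2).2

open Classical in
noncomputable instance [Fintype E] (N : Network V E) : Fintype N.Path :=
  Fintype.ofInjective (fun P : N.Path => (⟨P.edges, P.nodup_edges⟩ : {l : List E // l.Nodup}))
    (fun P Q h => Subtype.ext (Subtype.mk.inj h : P.edges = Q.edges))

/-- A parallel path network: distinct `s`,`t`-paths have no edge in common. -/
def IsParallelPath (N : Network V E) : Prop :=
  ∀ P Q : N.Path, P ≠ Q → ∀ e ∈ P.edges, e ∉ Q.edges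

/-- `z` is the queue mass, on `[0, ∞)`, of an edge of capacity `ν` with inflow rate `f`: the
(Caratheodory) solution, starting with an empty queue, of the queue dynamics
`z' = f - ν` where `z > 0` and `z' = max (f - ν) 0` where `z = 0`. -/
structure IsQueue (ν : ℝ) (f z : ℝ → ℝ) : Prop where
  nonneg : ∀ θ, 0 ≤ θ → 0 ≤ z θ
  continuousOn : ContinuousOn z (Set.Ici 0)
  dynamics : ∀ θ, 0 ≤ θ →
    z θ = ∫ ξ in (0 : ℝ)..θ, if 0 < z ξ then f ξ - ν else max (f ξ - ν) 0

/-- The time `T_e(θ) = θ + z_e(θ)/ν_e + τ_e` at which a particle that enters `e` at time `θ`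
leaves `e`, for given queue masses `z`. -/
noncomputable def exitTime (N : Network V E) (z : E → ℝ → ℝ) (e : E) (θ : ℝ) : ℝ :=
  θ + z e θ / N.capacity e + N.transit e

open Classical in
/-- The outflow rate of `e` at time `θ`, for given edge inflow rates `f` and queue masses `z`;
nothing leaves `e` before time `τ_e`. -/
noncomputable def outflow (N : Network V E) (f z : E → ℝ → ℝ) (e : E) (θ : ℝ) : ℝ :=
  if θ < N.transit e then 0
  else if 0 < z e (θ - N.transit e) then N.capacity e
  else min (f e (θ - N.transit e)) (N.capacity e)

open Classical in
/-- Follow the edge list `p`, starting at time `θ`, until vertex `v` is reached (or to the end of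
`p`), and return the time of arrival. -/
noncomputable def arrivalAlong (N : Network V E) (z : E → ℝ → ℝ) : List E → V → ℝ → ℝ
  | [], _, θ => θ
  | e :: p, v, θ => if N.src e = v then θ else N.arrivalAlong z p v (N.exitTime z e θ)

/-- The time `ℓ_v^P(θ)` at which particle `θ`, which leaves the source at time `θ`, arrives at the
vertex `v` of `P` using `P`. -/
noncomputable def arrival (N : Network V E) (z : E → ℝ → ℝ) (P : N.Path) (v : V) (θ : ℝ) : ℝ :=
  N.arrivalAlong z P.edges v θ

open Classical in
/-- A flow over time, given by path inflow rates together with the edge inflow rates and the queue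
masses that they induce. All functions of time are relevant on `[0, ∞)` only, and rates are
understood up to null sets. -/
structure FlowOverTime [Fintype E] (N : Network V E) where
  /-- `f_P^+` -/
  pathInflow : N.Path → ℝ → ℝ
  /-- `f_e^+` -/
  edgeInflow : E → ℝ → ℝ
  /-- `z_e` -/
  queue : E → ℝ → ℝ
  pathInflow_nonneg : ∀ P θ, 0 ≤ θ → 0 ≤ pathInflow P θ
  pathInflow_integrable : ∀ P θ, 0 ≤ θ → IntervalIntegrable (pathInflow P) volume 0 θ
  edgeInflow_nonneg : ∀ e θ, 0 ≤ θ → 0 ≤ edgeInflow e θ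
  edgeInflow_integrable : ∀ e θ, 0 ≤ θ → IntervalIntegrable (edgeInflow e) volume 0 θ
  isQueue : ∀ e, IsQueue (N.capacity e) (edgeInflow e) (queue e)
  /-- Flow conservation at every vertex except the sink. -/
  conservation : ∀ v, v ≠ N.sink → ∀ᵐ θ ∂volume.restrict (Set.Ici (0 : ℝ)),
    (∑ e with N.src e = v, edgeInflow e θ) -
      (∑ e with N.tgt e = v, N.outflow edgeInflow queue e θ) =
        if v = N.source then N.inflow else 0
  /-- The path inflow rates induce the edge inflow rates: the cumulative inflow `F_e^+(θ)` into `e`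
  is the mass of the particles that use a path through `e` and have reached the tail of `e` by
  time `θ`. -/
  induced : ∀ e θ, 0 ≤ θ → ∫ ξ in (0 : ℝ)..θ, edgeInflow e ξ =
    ∑ P : N.Path, ∫ ξ in {ξ | e ∈ P.edges ∧ 0 ≤ ξ ∧ N.arrival queue P (N.src e) ξ ≤ θ},
      pathInflow P ξ

/-- The cost `c_P = ∑_{e ∈ P} c_e`. -/
noncomputable def Path.cost {N : Network V E} (P : N.Path) : ℝ≥0 := (P.edges.map N.cost).sum

namespace FlowOverTime

variable [Fintype E] {N : Network V E}

/-- The time `ℓ_t^P(θ)` at which particle `θ` arrives at the sink using `P`. -/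
noncomputable def sinkArrival (f : FlowOverTime N) (P : N.Path) (θ : ℝ) : ℝ :=
  N.arrival f.queue P N.sink θ

open Classical in
/-- The cost `c_P(θ)` of particle `θ` along `P`: infinite unless it arrives before the deadline. -/
noncomputable def particleCost (f : FlowOverTime N) (P : N.Path) (θ : ℝ) : ℝ≥0∞ :=
  if f.sinkArrival P θ < N.deadline then (P.cost : ℝ≥0∞) else ⊤

/-- A Nash flow over time: flow is sent only into paths of currently minimum cost. -/
def IsNash (f : FlowOverTime N) : Prop :=
  ∀ᵐ θ ∂volume.restrict (Set.Ici (0 : ℝ)), ∀ P : N.Path, 0 < f.pathInflow P θ →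
    ∀ Q : N.Path, f.particleCost P θ ≤ f.particleCost Q θ

/-- The amount `M_f` of flow that arrives at the sink before the deadline. -/
noncomputable def throughput (f : FlowOverTime N) : ℝ≥0∞ :=
  ∑ P : N.Path, ∫⁻ θ in {θ | 0 ≤ θ ∧ f.sinkArrival P θ < N.deadline},
    ENNReal.ofReal (f.pathInflow P θ)

end FlowOverTime

/-- The largest throughput `M^*` over all flows over time. -/
noncomputable def optThroughput [Fintype E] (N : Network V E) : ℝ≥0∞ :=
  ⨆ f : FlowOverTime N, f.throughput

/-- The throughput-price of anarchy: the largest ratio `M^* / M_f` over all Nash flows `f`, which is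
`∞` if `M_f = 0 < M^*` for some Nash flow. -/
noncomputable def throughputPoA [Fintype E] (N : Network V E) : ℝ≥0∞ :=
  ⨆ (f : FlowOverTime N) (_ : f.IsNash), N.optThroughput / f.throughput

/-- `k` parallel links from `s = false` to `t = true`, each of capacity `1 / k` and transit time
`0`, with arbitrary costs `c`, inflow rate `u = 1` and deadline `D = 1`. -/
noncomputable def uniformLinks (k : ℕ) (c : Fin k → ℝ≥0) : Network Bool (Fin k) where
  src _ := false
  tgt _ := true
  source := false
  sink := true
  source_ne_sink := Bool.false_ne_true
  transit _ := 0
  capacity _ := 1 / (k : ℝ)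
  capacity_pos e := one_div_pos.mpr (Nat.cast_pos.mpr e.pos)
  cost := c
  inflow := 1
  inflow_pos := one_pos
  deadline := 1
  deadline_pos := one_pos

end Network

/-! Let `S` be the sum of the bottleneck capacities of the paths. Without transit times, and with
edge-disjoint paths, each path is a tandem of queues, which delays no particle longer than a single
queue at its bottleneck capacity would (`IsTandem`, `busyTime`).

Upper bound. Any flow over time has throughput at most `D * min u S` (`throughput_le`). For a Nash
flow, the potential `∑ μ_P * max (D - busyTime_P) 0 / (D - θ)` starts at `S`. Inflow during `[a, b]`
lowers it by at most `u * (b - a) / (D - b)`, so in the time scale `θ = D * (1 - exp (-y))` it falls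
at rate at most `u`. It is thus positive while `y < S / u`, and until then some path still meets the
deadline (`exists_busyTime_lt`). A Nash flow then uses only such paths, so it delivers at least `u *
D * (1 - exp (-S / u))`. With `x = S / u` the ratio is at most `min 1 x / (1 - exp (-x))`, which
concavity bounds by its value `e / (e - 1)` at `x = 1`.

Tightness. On `k` uniform links an even split delivers everything. A Nash flow may instead fill the
links one at a time, by increasing cost, each until its exit time reaches the deadline. Every burst
multiplies the time left by `1 - 1/k`, so the throughput is at most `1 - (1 - 1/k)^k`, which tends
to `1 - 1/e`. -/

namespace Network

/-! ### Dynamics of a single queue. -/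

namespace IsQueue

variable {ν : ℝ} {f z : ℝ → ℝ}

/-- The integrand of the queue dynamics is integrable. -/
theorem intervalIntegrable_rate (hq : IsQueue ν f z)
    (hf : ∀ θ, 0 ≤ θ → IntervalIntegrable f volume 0 θ) {θ : ℝ} (hθ : 0 ≤ θ) :
    IntervalIntegrable (fun ξ => if 0 < z ξ then f ξ - ν else max (f ξ - ν) 0) volume 0 θ := by
  rw [intervalIntegrable_iff_integrableOn_Ioc_of_le hθ]
  -- Only the restriction of `z` to `[0, ∞)` is continuous; clamping the argument makes the set
  -- where the queue is positive measurable.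
  have hz : Continuous (fun ξ => z (max 0 ξ)) :=
    hq.continuousOn.comp_continuous (by fun_prop) (fun ξ => le_max_left 0 ξ)
  have hfi : IntegrableOn (fun ξ => f ξ - ν) (Set.Ioc 0 θ) := by
    have := (intervalIntegrable_iff_integrableOn_Ioc_of_le hθ).mp (hf θ hθ)
    exact this.sub (by simp)
  have hpos : MeasurableSet {ξ : ℝ | 0 < z (max 0 ξ)} :=
    (isOpen_lt continuous_const hz).measurableSet
  have key := Integrable.piecewise (μ := volume.restrict (Set.Ioc 0 θ)) hpos
    (Integrable.integrableOn hfi) (Integrable.integrableOn (Integrable.pos_part hfi))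
  refine IntegrableOn.congr_fun key (fun ξ hξ => ?_) measurableSet_Ioc
  simp [Set.piecewise, max_eq_right hξ.1.le]

theorem sub_eq_integral (hq : IsQueue ν f z)
    (hf : ∀ θ, 0 ≤ θ → IntervalIntegrable f volume 0 θ) {a b : ℝ} (ha : 0 ≤ a) (hab : a ≤ b) :
    z b - z a = ∫ ξ in a..b, if 0 < z ξ then f ξ - ν else max (f ξ - ν) 0 := by
  rw [hq.dynamics b (ha.trans hab), hq.dynamics a ha, intervalIntegral.integral_interval_sub_left
    (hq.intervalIntegrable_rate hf (ha.trans hab)) (hq.intervalIntegrable_rate hf ha)]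

theorem apply_zero (hq : IsQueue ν f z) : z 0 = 0 := by
  simpa using hq.dynamics 0 le_rfl

end IsQueue

theorem intervalIntegrable_of_zero {f : ℝ → ℝ}
    (hf : ∀ θ, 0 ≤ θ → IntervalIntegrable f volume 0 θ) {a b : ℝ} (ha : 0 ≤ a) (hb : 0 ≤ b) :
    IntervalIntegrable f volume a b :=
  (hf a ha).symm.trans (hf b hb)

theorem integral_nonneg_of_nonneg {f : ℝ → ℝ} (hf : ∀ θ, 0 ≤ θ → 0 ≤ f θ) {a b : ℝ}
    (ha : 0 ≤ a) (hab : a ≤ b) : 0 ≤ ∫ ξ in a..b, f ξ :=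
  intervalIntegral.integral_nonneg hab fun ξ hξ => hf ξ (ha.trans hξ.1)

theorem integral_add_of_zero {f : ℝ → ℝ}
    (hf : ∀ θ, 0 ≤ θ → IntervalIntegrable f volume 0 θ) {a b c : ℝ} (ha : 0 ≤ a) (hb : 0 ≤ b)
    (hc : 0 ≤ c) : (∫ ξ in a..b, f ξ) + ∫ ξ in b..c, f ξ = ∫ ξ in a..c, f ξ :=
  intervalIntegral.integral_add_adjacent_intervals (intervalIntegrable_of_zero hf ha hb)
    (intervalIntegrable_of_zero hf hb hc)

namespace IsQueue

variable {ν : ℝ} {f z : ℝ → ℝ}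

/-- Both branches of the dynamics are at least `f - ν`: an edge never discharges faster than its
capacity. -/
theorem le_sub (hq : IsQueue ν f z)
    (hf : ∀ θ, 0 ≤ θ → IntervalIntegrable f volume 0 θ) {a b : ℝ} (ha : 0 ≤ a) (hab : a ≤ b) :
    (∫ ξ in a..b, f ξ) - ν * (b - a) ≤ z b - z a := by
  have hfi := intervalIntegrable_of_zero hf ha (ha.trans hab)
  have hgi := intervalIntegrable_of_zero (fun θ hθ => hq.intervalIntegrable_rate hf (θ := θ) hθ)
    ha (ha.trans hab)
  have h := intervalIntegral.integral_mono_on hab (hfi.sub (intervalIntegrable_const (c := ν))) hgi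
    (fun ξ _ => by split_ifs; exacts [le_rfl, le_max_left _ _])
  rw [intervalIntegral.integral_sub hfi intervalIntegrable_const,
    intervalIntegral.integral_const] at h
  rw [hq.sub_eq_integral hf ha hab]
  simpa [mul_comm] using h

/-- The queue at time `θ` consists of the flow that entered since the queue was last empty. -/
theorem exists_busy_start (hq : IsQueue ν f z)
    (hf : ∀ θ, 0 ≤ θ → IntervalIntegrable f volume 0 θ) {θ : ℝ} (hθ : 0 ≤ θ) :
    ∃ s ∈ Set.Icc 0 θ, z θ = (∫ ξ in s..θ, f ξ) - ν * (θ - s) := by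
  have hc : ContinuousOn z (Set.Icc 0 θ) := hq.continuousOn.mono fun x hx => hx.1
  have hcomp : IsCompact (Set.Icc 0 θ ∩ z ⁻¹' {0}) :=
    isCompact_Icc.of_isClosed_subset
      (hc.preimage_isClosed_of_isClosed isClosed_Icc isClosed_singleton) Set.inter_subset_left
  obtain ⟨s, ⟨hs, hs0⟩, hmax⟩ := hcomp.exists_isGreatest ⟨0, ⟨le_rfl, hθ⟩, hq.apply_zero⟩
  refine ⟨s, hs, ?_⟩
  have hfi := intervalIntegrable_of_zero hf hs.1 hθ
  have h := hq.sub_eq_integral hf hs.1 hs.2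
  have hs0 : z s = 0 := hs0
  rw [hs0, sub_zero] at h
  rw [h]
  have : ∀ ξ ∈ Set.uIoc s θ, (if 0 < z ξ then f ξ - ν else max (f ξ - ν) 0) = f ξ - ν := by
    intro ξ hξ
    rw [Set.uIoc_of_le hs.2] at hξ
    have h0 : 0 ≤ ξ := hs.1.trans hξ.1.le
    refine if_pos (lt_of_le_of_ne (hq.nonneg ξ h0) fun h => ?_)
    exact absurd (hmax ⟨⟨h0, hξ.2⟩, h.symm⟩) (not_le.mpr hξ.1)
  rw [intervalIntegral.integral_congr_ae (.of_forall this),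
    intervalIntegral.integral_sub hfi intervalIntegrable_const, intervalIntegral.integral_const]
  simp [mul_comm]

end IsQueue

/-! ### Tandems of queues. -/

/-- `ℓ θ` is the time at which a particle that starts at time `θ` leaves a sequence of queues
without transit times which is fed at rate `f` and whose capacities are the elements of `S`. -/
structure IsTandem (f : ℝ → ℝ) (S : Set ℝ) (ℓ : ℝ → ℝ) : Prop where
  continuousOn : ContinuousOn ℓ (Set.Ici 0)
  zero : ℓ 0 = 0
  monotoneOn : MonotoneOn ℓ (Set.Ici 0)
  le : ∀ θ, 0 ≤ θ → θ ≤ ℓ θ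
  flat : ∀ a b, 0 ≤ a → a ≤ b → ℓ a = ℓ b → ∫ ξ in a..b, f ξ = 0
  upper : ∀ μ, 0 < μ → (∀ ν ∈ S, μ ≤ ν) → ∀ b, 0 ≤ b →
    ∃ s ∈ Set.Icc 0 b, ℓ b ≤ s + (∫ ξ in s..b, f ξ) / μ
  lower : ∀ ν ∈ S, ∀ b, 0 ≤ b → ∫ ξ in (0 : ℝ)..b, f ξ ≤ ν * ℓ b

namespace IsTandem

variable {f ℓ g z : ℝ → ℝ} {S : Set ℝ} {ν : ℝ}

theorem nil (f : ℝ → ℝ) : IsTandem f ∅ id where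
  continuousOn := continuousOn_id
  zero := rfl
  monotoneOn := monotone_id.monotoneOn _
  le _ _ := le_rfl
  flat a b _ _ h := by obtain rfl : a = b := h; simp
  upper μ _ _ b hb := ⟨b, ⟨hb, le_rfl⟩, by simp⟩
  lower := by simp

/-- The sublevel set is an interval `[0, m]` with `m ≥ θ`. If `m > θ`, then `ℓ` is constant on `[θ,
m]`, and `flat` says that no mass starts there. -/
theorem integral_sublevel (h : IsTandem f S ℓ)
    (hfi : ∀ θ, 0 ≤ θ → IntervalIntegrable f volume 0 θ) {θ : ℝ} (hθ : 0 ≤ θ) :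
    ∫ ξ in {ξ | 0 ≤ ξ ∧ ℓ ξ ≤ ℓ θ}, f ξ = ∫ ξ in (0 : ℝ)..θ, f ξ := by
  have hset : {ξ | 0 ≤ ξ ∧ ℓ ξ ≤ ℓ θ} = Set.Icc 0 (ℓ θ) ∩ ℓ ⁻¹' Set.Iic (ℓ θ) := by
    ext ξ
    simp only [Set.mem_ofPred_eq, Set.mem_inter_iff, Set.mem_Icc, Set.mem_preimage, Set.mem_Iic]
    exact ⟨fun hξ => ⟨⟨hξ.1, (h.le ξ hξ.1).trans hξ.2⟩, hξ.2⟩, fun hξ => ⟨hξ.1.1, hξ.2⟩⟩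
  have hcomp : IsCompact {ξ | 0 ≤ ξ ∧ ℓ ξ ≤ ℓ θ} := by
    rw [hset]
    exact isCompact_Icc.of_isClosed_subset ((h.continuousOn.mono fun x hx =>
      hx.1).preimage_isClosed_of_isClosed isClosed_Icc isClosed_Iic) Set.inter_subset_left
  obtain ⟨m, ⟨hm0, hm⟩, hmax⟩ := hcomp.exists_isGreatest ⟨θ, hθ, le_rfl⟩
  have hθm : θ ≤ m := hmax ⟨hθ, le_rfl⟩
  have : {ξ | 0 ≤ ξ ∧ ℓ ξ ≤ ℓ θ} = Set.Icc 0 m := by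
    ext ξ
    exact ⟨fun hξ => ⟨hξ.1, hmax hξ⟩, fun hξ => ⟨hξ.1, (h.monotoneOn hξ.1 hm0 hξ.2).trans hm⟩⟩
  rw [this, integral_Icc_eq_integral_Ioc, ← intervalIntegral.integral_of_le hm0,
    ← integral_add_of_zero hfi le_rfl hθ hm0,
    h.flat θ m hθ hθm (le_antisymm (h.monotoneOn hθ hm0 hθm) hm), add_zero]

/-- Appending a queue to a sequence of queues. -/
theorem snoc (h : IsTandem f S ℓ) (hν : 0 < ν)
    (hf : ∀ θ, 0 ≤ θ → 0 ≤ f θ) (hfi : ∀ θ, 0 ≤ θ → IntervalIntegrable f volume 0 θ)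
    (hgi : ∀ θ, 0 ≤ θ → IntervalIntegrable g volume 0 θ)
    (hq : IsQueue ν g z)
    (hind : ∀ θ, 0 ≤ θ → ∫ ξ in (0 : ℝ)..θ, g ξ = ∫ ξ in {ξ | 0 ≤ ξ ∧ ℓ ξ ≤ θ}, f ξ) :
    IsTandem f (insert ν S) (fun θ => ℓ θ + z (ℓ θ) / ν) := by
  have h0 : ∀ θ, 0 ≤ θ → 0 ≤ ℓ θ := fun θ hθ => hθ.trans (h.le θ hθ)
  -- The mass that reaches the new queue between `ℓ a` and `ℓ b` is the mass that started between
  -- `a` and `b`.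
  have hG : ∀ a b, 0 ≤ a → a ≤ b → ∫ ξ in ℓ a..ℓ b, g ξ = ∫ ξ in a..b, f ξ := by
    intro a b ha hab
    have hb := ha.trans hab
    have e1 := integral_add_of_zero hgi le_rfl (h0 a ha) (h0 b hb)
    have e2 := integral_add_of_zero hfi le_rfl ha hb
    rw [hind _ (h0 a ha), hind _ (h0 b hb), h.integral_sublevel hfi ha,
      h.integral_sublevel hfi hb] at e1
    linarith
  -- Exit times are spaced by at least the mass in between divided by `ν`; monotonicity, `flat` and
  -- the new case of `lower` all follow.
  have hstep : ∀ a b, 0 ≤ a → a ≤ b →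
      (∫ ξ in a..b, f ξ) / ν ≤ (ℓ b + z (ℓ b) / ν) - (ℓ a + z (ℓ a) / ν) := by
    intro a b ha hab
    have := hq.le_sub hgi (h0 a ha) (h.monotoneOn ha (ha.trans hab) hab)
    rw [hG a b ha hab] at this
    rw [div_le_iff₀ hν]
    have e : (ℓ b + z (ℓ b) / ν - (ℓ a + z (ℓ a) / ν)) * ν =
      ν * (ℓ b - ℓ a) + (z (ℓ b) - z (ℓ a)) := by field_simp; ring
    linarith
  have hle : ∀ θ, 0 ≤ θ → ℓ θ ≤ ℓ θ + z (ℓ θ) / ν := fun θ hθ =>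
    le_add_of_nonneg_right (div_nonneg (hq.nonneg _ (h0 θ hθ)) hν.le)
  refine ⟨?_, ?_, ?_, ?_, ?_, ?_, ?_⟩
  · exact h.continuousOn.add ((hq.continuousOn.comp h.continuousOn h0).div_const ν)
  · simp [h.zero, hq.apply_zero]
  · intro a ha b hb hab
    have := hstep a b ha hab
    have := div_nonneg (integral_nonneg_of_nonneg hf ha hab) hν.le
    linarith
  · exact fun θ hθ => (h.le θ hθ).trans (hle θ hθ)
  · intro a b ha hab heq
    have h1 := hstep a b ha hab
    rw [heq, sub_self, div_le_iff₀ hν, zero_mul] at h1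
    exact le_antisymm h1 (integral_nonneg_of_nonneg hf ha hab)
  -- The busy period of the new queue begins at some `ℓ a`. The mass that starts after `a` is
  -- charged to this queue, and the induction hypothesis covers the time up to `ℓ a`.
  · intro μ hμ hμS b hb
    obtain ⟨s, hs, hzs⟩ := hq.exists_busy_start hgi (h0 b hb)
    have hivt := intermediate_value_Icc hb (h.continuousOn.mono fun x hx => hx.1)
    rw [h.zero] at hivt
    obtain ⟨a, ha, rfl⟩ := hivt hs
    obtain ⟨t, ht, hta⟩ := h.upper μ hμ (fun ν' hν' => hμS ν' (Set.mem_insert_of_mem _ hν')) a ha.1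
    refine ⟨t, ⟨ht.1, ht.2.trans ha.2⟩, ?_⟩
    rw [hG a b ha.1 ha.2] at hzs
    have e : ℓ b + z (ℓ b) / ν = ℓ a + (∫ ξ in a..b, f ξ) / ν := by
      rw [hzs]; field_simp; ring
    have hdiv : (∫ ξ in a..b, f ξ) / ν ≤ (∫ ξ in a..b, f ξ) / μ :=
      div_le_div_of_nonneg_left (integral_nonneg_of_nonneg hf ha.1 ha.2) hμ
        (hμS ν (Set.mem_insert _ _))
    rw [← integral_add_of_zero hfi ht.1 ha.1 hb, add_div]
    linarith
  · intro ν' hν' b hb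
    rcases Set.mem_insert_iff.mp hν' with rfl | hν'
    · have := hstep 0 b le_rfl hb
      rw [h.zero, hq.apply_zero, div_le_iff₀ hν] at this
      simp only [zero_div, add_zero, sub_zero] at this
      linarith
    · have h1 := h.lower ν' hν' b hb
      -- `S` is an arbitrary set of reals. A negative element forces `ℓ b = 0`, hence `b = 0`.
      by_cases hp : 0 ≤ ν'
      · exact h1.trans (mul_le_mul_of_nonneg_left (hle b hb) hp)
      · have := integral_nonneg_of_nonneg hf le_rfl hb
        have h2 := h0 b hb
        have h3 : ℓ b = 0 := by
          by_contra hne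
          have : 0 < ℓ b := lt_of_le_of_ne h2 (Ne.symm hne)
          nlinarith
        have : b = 0 := le_antisymm (h3 ▸ h.le b hb) hb
        subst this
        simp [h.zero, hq.apply_zero]

end IsTandem

end Network
-- The bottleneck queue and the potential argument.
namespace Network

/-- The time at which a particle that starts at time `b` leaves a single queue of capacity `μ`
without transit time that is fed at rate `f`. -/
noncomputable def busyTime (μ : ℝ) (f : ℝ → ℝ) (b : ℝ) : ℝ :=
  sSup ((fun s => s + (∫ ξ in s..b, f ξ) / μ) '' Set.Icc 0 b)

section busyTime

variable {μ : ℝ} {f : ℝ → ℝ}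

theorem le_busyTime (hμ : 0 < μ) (hf : ∀ θ, 0 ≤ θ → 0 ≤ f θ)
    (hfi : ∀ θ, 0 ≤ θ → IntervalIntegrable f volume 0 θ)
    {b s : ℝ} (hs : s ∈ Set.Icc 0 b) :
    s + (∫ ξ in s..b, f ξ) / μ ≤ busyTime μ f b := by
  refine le_csSup ⟨b + (∫ ξ in (0 : ℝ)..b, f ξ) / μ, ?_⟩ ⟨s, hs, rfl⟩
  rintro _ ⟨s, hs, rfl⟩
  have h1 := integral_add_of_zero hfi le_rfl hs.1 (hs.1.trans hs.2)
  have h2 := integral_nonneg_of_nonneg hf le_rfl hs.1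
  have h3 := hs.2
  dsimp only
  gcongr
  linarith

theorem self_le_busyTime (hμ : 0 < μ) (hf : ∀ θ, 0 ≤ θ → 0 ≤ f θ)
    (hfi : ∀ θ, 0 ≤ θ → IntervalIntegrable f volume 0 θ)
    {b : ℝ} (hb : 0 ≤ b) : b ≤ busyTime μ f b := by
  simpa using le_busyTime hμ hf hfi (s := b) ⟨hb, le_rfl⟩

/-- A busy period that starts before `a` is bounded through `busyTime μ f a`, a later one through
its start, which is at most `b`. In both cases the mass still to be added lies in `[a, b]`. -/
theorem busyTime_le (hμ : 0 < μ) (hf : ∀ θ, 0 ≤ θ → 0 ≤ f θ)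
    (hfi : ∀ θ, 0 ≤ θ → IntervalIntegrable f volume 0 θ)
    {a b : ℝ} (ha : 0 ≤ a) (hab : a ≤ b) :
    busyTime μ f b ≤ max (busyTime μ f a) b + (∫ ξ in a..b, f ξ) / μ := by
  have hb := ha.trans hab
  refine csSup_le ⟨_, b, ⟨hb, le_rfl⟩, rfl⟩ ?_
  rintro _ ⟨s, hs, rfl⟩
  dsimp only
  rcases le_total s a with hsa | has
  · have h1 := le_busyTime hμ hf hfi (b := a) ⟨hs.1, hsa⟩
    rw [← integral_add_of_zero hfi hs.1 ha hb, add_div]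
    have := le_max_left (busyTime μ f a) b
    linarith
  · have h1 := integral_add_of_zero hfi ha hs.1 hb
    have h2 := integral_nonneg_of_nonneg hf ha has
    have h3 := le_max_right (busyTime μ f a) b
    have h4 : (∫ ξ in s..b, f ξ) / μ ≤ (∫ ξ in a..b, f ξ) / μ := by gcongr; linarith
    linarith [hs.2]

end busyTime

/-- A function `Y` that decreases by at most `u (exp δ - 1)` over each step of length `δ` decreases
at most at rate `u`. -/
theorem sub_mul_le_of_exp_step {Y : ℝ → ℝ} {u : ℝ} (hu : 0 ≤ u)
    (hY : ∀ y δ, 0 ≤ y → 0 ≤ δ → Y y - u * (Real.exp δ - 1) ≤ Y (y + δ)) {y : ℝ} (hy : 0 ≤ y) :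
    Y 0 - u * y ≤ Y y := by
  -- Cut `[0, y]` into `n + 1` equal steps `δ`. Since `exp δ - 1 ≤ δ * exp δ`, the total loss is at
  -- most `u * y * exp δ`, and `δ → 0`.
  have hn : ∀ n : ℕ, Y 0 - u * y * Real.exp (y / ((n : ℝ) + 1)) ≤ Y y := by
    intro n
    have hpos : (0 : ℝ) < (n : ℝ) + 1 := by positivity
    set δ := y / ((n : ℝ) + 1) with hδ
    have hδ0 : 0 ≤ δ := by positivity
    have hm : ∀ m : ℕ, Y 0 - m * (u * (Real.exp δ - 1)) ≤ Y (m * δ) := by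
      intro m
      induction m with
      | zero => simp
      | succ m ih =>
        have := hY (m * δ) δ (by positivity) hδ0
        push_cast
        rw [add_one_mul, add_one_mul]
        linarith
    have h := hm (n + 1)
    have e : ((n + 1 : ℕ) : ℝ) * δ = y := by push_cast; rw [hδ]; field_simp
    rw [e] at h
    have hexp : Real.exp δ - 1 ≤ δ * Real.exp δ := by
      have h1 := Real.add_one_le_exp (-δ)
      have h2 : Real.exp (-δ) * Real.exp δ = 1 := by rw [← Real.exp_add]; simp
      nlinarith [Real.exp_pos δ]
    have : ((n + 1 : ℕ) : ℝ) * (u * (Real.exp δ - 1)) ≤ u * y * Real.exp δ := by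
      calc ((n + 1 : ℕ) : ℝ) * (u * (Real.exp δ - 1))
          ≤ ((n + 1 : ℕ) : ℝ) * (u * (δ * Real.exp δ)) := by gcongr
        _ = u * (((n + 1 : ℕ) : ℝ) * δ) * Real.exp δ := by ring
        _ = _ := by rw [e]
    linarith
  have hlim : Tendsto (fun n : ℕ => Y 0 - u * y * Real.exp (y / ((n : ℝ) + 1))) atTop
      (𝓝 (Y 0 - u * y * Real.exp 0)) := by
    refine tendsto_const_nhds.sub (Tendsto.const_mul _ ?_)
    refine (Real.continuous_exp.tendsto 0).comp ?_
    exact tendsto_const_nhds.div_atTop (tendsto_natCast_atTop_atTop.atTop_add tendsto_const_nhds)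
  rw [Real.exp_zero, mul_one] at hlim
  exact le_of_tendsto' hlim hn

/-- If queues of capacities `μ i` are fed at total rate `u`, then until time
`D (1 - exp (-∑ μ i / u))` some queue can be left before time `D`. -/
theorem exists_busyTime_lt {ι : Type*} [Fintype ι] {μ : ι → ℝ} {f : ι → ℝ → ℝ} {u D : ℝ}
    (hμ : ∀ i, 0 < μ i) (hf : ∀ i θ, 0 ≤ θ → 0 ≤ f i θ)
    (hfi : ∀ i θ, 0 ≤ θ → IntervalIntegrable (f i) volume 0 θ) (hu : 0 < u) (hD : 0 < D)
    (hsum : ∀ b, 0 ≤ b → ∑ i, ∫ ξ in (0 : ℝ)..b, f i ξ = u * b) {b : ℝ} (hb : 0 ≤ b)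
    (hbD : b < D * (1 - Real.exp (-((∑ i, μ i) / u)))) :
    ∃ i, busyTime (μ i) (f i) b < D := by
  by_contra! hcon
  -- The capacity still usable before the deadline, normalised by the time left. It vanishes at `b`
  -- if every queue is saturated.
  set X : ℝ → ℝ := fun a => ∑ i, μ i * max (D - busyTime (μ i) (f i) a) 0 / (D - a) with hX
  have hstep : ∀ a b, 0 ≤ a → a ≤ b → b < D → X a - u * (b - a) / (D - b) ≤ X b := by
    intro a b ha hab hbD
    have hb := ha.trans hab
    have hub : u * (b - a) = ∑ i, ∫ ξ in a..b, f i ξ := by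
      rw [mul_sub, ← hsum b hb, ← hsum a ha, ← Finset.sum_sub_distrib]
      exact Finset.sum_congr rfl fun i _ => by rw [← integral_add_of_zero (hfi i) le_rfl ha hb]; ring
    rw [hub, Finset.sum_div, hX, ← Finset.sum_sub_distrib]
    refine Finset.sum_le_sum fun i _ => ?_
    have hDa : 0 < D - a := by linarith
    have hDb : 0 < D - b := by linarith
    have h1 := busyTime_le (hμ i) (hf i) (hfi i) ha hab
    have h2 := self_le_busyTime (hμ i) (hf i) (hfi i) ha
    set A := ∫ ξ in a..b, f i ξ
    have hA : 0 ≤ A := integral_nonneg_of_nonneg (hf i) ha hab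
    set p := busyTime (μ i) (f i) a
    set q := busyTime (μ i) (f i) b
    have hAμ : A = μ i * (A / μ i) := by field_simp [(hμ i).ne']
    have hkey : μ i * (max (D - p) 0 * ((D - b) / (D - a))) - A ≤ μ i * max (D - q) 0 := by
      have hr1 : (D - b) / (D - a) ≤ 1 := (div_le_one hDa).mpr (by linarith)
      have hr0 : 0 ≤ (D - b) / (D - a) := by positivity
      have : max (D - p) 0 * ((D - b) / (D - a)) - A / μ i ≤ max (D - q) 0 := by
        have hAd : 0 ≤ A / μ i := div_nonneg hA (hμ i).le
        rcases le_total (D - p) 0 with hp | hp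
        · rw [max_eq_right hp, zero_mul]
          linarith [le_max_right (D - q) 0]
        · rw [max_eq_left hp]
          -- `c1` serves a queue that is still busy at `b`, where `q ≤ p + A / μ i`. `c2` serves `p
          -- ≤ b`, where `q ≤ b + A / μ i`; it uses `a ≤ p`.
          have c1 : (D - p) * ((D - b) / (D - a)) ≤ D - p := mul_le_of_le_one_right hp hr1
          have c2 : (D - p) * ((D - b) / (D - a)) ≤ D - b := by
            rw [mul_div_left_comm]
            exact mul_le_of_le_one_right hDb.le ((div_le_one hDa).mpr (by linarith))
          have c3 := le_max_left (D - q) 0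
          rcases le_total p b with hpb | hpb
          · rw [max_eq_right hpb] at h1; linarith
          · rw [max_eq_left hpb] at h1; linarith
      have := mul_le_mul_of_nonneg_left this (hμ i).le
      rw [mul_sub, ← hAμ] at this
      exact this
    have e : μ i * max (D - p) 0 / (D - a) - A / (D - b) =
        (μ i * (max (D - p) 0 * ((D - b) / (D - a))) - A) / (D - b) := by
      field_simp
    rw [e]
    gcongr
  have hexp := Real.exp_pos (-((∑ i, μ i) / u))
  have hbD' : b < D := by nlinarith
  have hDb : 0 < (D - b) / D := div_pos (by linarith) hD
  -- In this time scale `D - a = exp δ * (D - b)` over a step `δ`, so the loss `u * (b - a) / (D -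
  -- b)` is exactly `u * (exp δ - 1)`.
  set y := -Real.log ((D - b) / D) with hy
  have hy0 : 0 ≤ y := by
    have := Real.log_nonpos hDb.le ((div_le_one hD).mpr (by linarith))
    linarith
  have hyb : D * (1 - Real.exp (-y)) = b := by
    rw [hy, neg_neg, Real.exp_log hDb]; field_simp; ring
  have hyS : u * y < ∑ i, μ i := by
    have : Real.exp (-((∑ i, μ i) / u)) < Real.exp (-y) := by
      rw [← hyb] at hbD
      have := lt_of_mul_lt_mul_left hbD hD.le
      linarith
    have := Real.exp_lt_exp.mp this
    have : y < (∑ i, μ i) / u := by linarith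
    rw [lt_div_iff₀ hu] at this
    linarith
  have hmain := sub_mul_le_of_exp_step (Y := fun y => X (D * (1 - Real.exp (-y)))) hu.le
    (fun y δ hy hδ => by
      have e1 : Real.exp (-y) ≤ 1 := Real.exp_le_one_iff.mpr (by linarith)
      have e2 : Real.exp (-(y + δ)) ≤ Real.exp (-y) := Real.exp_le_exp.mpr (by linarith)
      have e3 := Real.exp_pos (-(y + δ))
      have e4 : Real.exp (-y) = Real.exp δ * Real.exp (-(y + δ)) := by
        rw [← Real.exp_add]; ring_nf
      have := hstep (D * (1 - Real.exp (-y))) (D * (1 - Real.exp (-(y + δ))))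
        (mul_nonneg hD.le (by linarith)) (by gcongr) (by nlinarith)
      refine le_of_eq_of_le ?_ this
      rw [e4]
      field_simp
      ring) hy0
  have hX0 : X (D * (1 - Real.exp (-0))) = ∑ i, μ i := by
    simp only [hX, neg_zero, Real.exp_zero, sub_self, mul_zero, sub_zero]
    refine Finset.sum_congr rfl fun i _ => ?_
    have : busyTime (μ i) (f i) 0 = 0 := by simp [busyTime]
    rw [this, sub_zero, max_eq_left hD.le]
    field_simp
  have hXb : X b = 0 := by
    refine Finset.sum_eq_zero fun i _ => ?_
    rw [max_eq_right (by linarith [hcon i])]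
    simp
  rw [hX0, hyb, hXb] at hmain
  linarith

end Network
-- Vertices and arrival times along a path.
namespace Network

variable {V E : Type*} {N : Network V E}

/-- The vertex sequence can be read from heads or from tails. Simplicity, stated with heads, thus
also makes the tails distinct and different from the sink. -/
theorem IsWalk.cons_map_tgt {p : List E} {a b : V} (h : N.IsWalk a p b) :
    a :: p.map N.tgt = p.map N.src ++ [b] := by
  induction p generalizing a with
  | nil => simpa [IsWalk] using h
  | cons e p ih => simp [h.1, ih h.2]

namespace Path

theorem nodup_map_src_append (P : N.Path) : (P.edges.map N.src ++ [N.sink]).Nodup := by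
  have := P.2.2
  rwa [P.2.1.cons_map_tgt] at this

theorem src_ne_sink (P : N.Path) {e : E} (he : e ∈ P.edges) : N.src e ≠ N.sink := by
  have := (List.nodup_append.mp P.nodup_map_src_append).2.2
  exact this _ (List.mem_map_of_mem he) _ (by simp)

theorem src_injective (P : N.Path) {e e' : E} (he : e ∈ P.edges) (he' : e' ∈ P.edges)
    (h : N.src e = N.src e') : e = e' :=
  List.inj_on_of_nodup_map (List.nodup_append.mp P.nodup_map_src_append).1 he he' h

theorem tgt_ne_source (P : N.Path) {e : E} (he : e ∈ P.edges) : N.tgt e ≠ N.source := fun h =>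
  (List.nodup_cons.mp P.2.2).1 (h ▸ List.mem_map_of_mem he)

theorem exists_src_eq_source (P : N.Path) : ∃ e ∈ P.edges, N.src e = N.source := by
  have h := P.2.1
  change N.IsWalk N.source P.edges N.sink at h
  cases hp : P.edges with
  | nil => rw [hp] at h; exact absurd h N.source_ne_sink
  | cons e p => rw [hp] at h; exact ⟨e, by simp, h.1⟩

/-- Every path has a bottleneck. -/
theorem exists_bottleneck (P : N.Path) :
    ∃ e ∈ P.edges, ∀ e' ∈ P.edges, N.capacity e ≤ N.capacity e' := by
  classical
  obtain ⟨e₀, he₀, -⟩ := P.exists_src_eq_source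
  obtain ⟨e, he, hmin⟩ := P.edges.toFinset.exists_min_image N.capacity ⟨e₀, by simpa using he₀⟩
  exact ⟨e, by simpa using he, fun e' he' => hmin e' (by simpa using he')⟩

/-- The capacity of a path is the smallest capacity of its edges. -/
noncomputable def capacity (P : N.Path) : ℝ := N.capacity P.exists_bottleneck.choose

theorem capacity_pos (P : N.Path) : 0 < P.capacity := N.capacity_pos _

end Path

/-- The time at which a particle that enters the first of the edges `p` at time `θ` leaves the last
one. -/
noncomputable def exitAlong (N : Network V E) (z : E → ℝ → ℝ) (p : List E) (θ : ℝ) : ℝ :=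
  p.foldl (fun t e => N.exitTime z e t) θ

theorem arrivalAlong_eq_exitAlong {z : E → ℝ → ℝ} {p : List E} {v : V}
    (h : ∀ e ∈ p, N.src e ≠ v) (θ : ℝ) : N.arrivalAlong z p v θ = N.exitAlong z p θ := by
  induction p generalizing θ with
  | nil => rfl
  | cons e p ih =>
    rw [arrivalAlong, if_neg (h e (by simp)), ih fun e' he' => h e' (by simp [he'])]
    rfl

theorem arrivalAlong_append_cons {z : E → ℝ → ℝ} {p q : List E} {e : E}
    (h : ∀ e' ∈ p, N.src e' ≠ N.src e) (θ : ℝ) :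
    N.arrivalAlong z (p ++ e :: q) (N.src e) θ = N.exitAlong z p θ := by
  induction p generalizing θ with
  | nil => simp [arrivalAlong, exitAlong]
  | cons e' p ih =>
    rw [List.cons_append, arrivalAlong, if_neg (h e' (by simp)),
      ih fun e' he' => h e' (by simp [he'])]
    rfl

/-! ### Throughput bounds for arbitrary flows and for Nash flows. -/

namespace FlowOverTime

variable [Fintype E] (f : FlowOverTime N)

theorem integral_edgeInflow (hN : N.IsParallelPath) {P : N.Path} {e : E} (he : e ∈ P.edges)
    {θ : ℝ} (hθ : 0 ≤ θ) : ∫ ξ in (0 : ℝ)..θ, f.edgeInflow e ξ =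
      ∫ ξ in {ξ | 0 ≤ ξ ∧ N.arrival f.queue P (N.src e) ξ ≤ θ}, f.pathInflow P ξ := by
  rw [f.induced e θ hθ, Finset.sum_eq_single P]
  · simp [he]
  · intro Q _ hQ
    have : e ∉ Q.edges := hN P Q (Ne.symm hQ) e he
    simp [this]
  · simp

/-- In a parallel path network without transit times every path is a sequence of queues. -/
theorem isTandem (hN : N.IsParallelPath) (hτ : ∀ e, N.transit e = 0) (P : N.Path)
    (p q : List E) (h : P.edges = p ++ q) :
    IsTandem (f.pathInflow P) {ν | ∃ e ∈ p, N.capacity e = ν} (N.exitAlong f.queue p) := by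
  -- Edges are appended at the end, because the inflow into an edge is governed by the exit time of
  -- the prefix before it.
  induction p using List.reverseRecOn generalizing q with
  | nil =>
    have : IsTandem (f.pathInflow P) ∅ (N.exitAlong f.queue []) := IsTandem.nil (f.pathInflow P)
    simpa using this
  | append_singleton p e ih =>
    rw [List.append_assoc, List.singleton_append] at h
    have he : e ∈ P.edges := by simp [h]
    have hp : ∀ e' ∈ p, N.src e' ≠ N.src e := by
      intro e' he' heq
      have hmem : e' ∈ P.edges := by simp [h, he']
      obtain rfl := P.src_injective hmem he heq
      have hnd := P.nodup_edges
      rw [h] at hnd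
      exact (List.nodup_append.mp hnd).2.2 e' he' e' (by simp) rfl
    have key := (ih (e :: q) h).snoc (N.capacity_pos e) (f.pathInflow_nonneg P)
      (f.pathInflow_integrable P) (f.edgeInflow_integrable e) (f.isQueue e) (fun θ hθ => by
        rw [f.integral_edgeInflow hN he hθ]
        simp only [arrival, h, arrivalAlong_append_cons hp])
    have hset : {ν | ∃ e' ∈ p ++ [e], N.capacity e' = ν} =
        insert (N.capacity e) {ν | ∃ e' ∈ p, N.capacity e' = ν} := by
      ext ν
      simp only [List.mem_append, List.mem_singleton, Set.mem_ofPred_eq, Set.mem_insert_iff]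
      constructor
      · rintro ⟨e', he' | rfl, rfl⟩
        exacts [Or.inr ⟨e', he', rfl⟩, Or.inl rfl]
      · rintro (rfl | ⟨e', he', rfl⟩)
        exacts [⟨e, Or.inr rfl, rfl⟩, ⟨e', Or.inl he', rfl⟩]
    have hfun : N.exitAlong f.queue (p ++ [e]) = fun θ => N.exitAlong f.queue p θ +
        f.queue e (N.exitAlong f.queue p θ) / N.capacity e := by
      ext θ
      simp [exitAlong, exitTime, hτ]
    rw [hset, hfun]
    exact key

theorem isTandem_sinkArrival (hN : N.IsParallelPath) (hτ : ∀ e, N.transit e = 0) (P : N.Path) :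
    IsTandem (f.pathInflow P) {ν | ∃ e ∈ P.edges, N.capacity e = ν} (f.sinkArrival P) := by
  have h : f.sinkArrival P = N.exitAlong f.queue P.edges := by
    ext θ
    exact arrivalAlong_eq_exitAlong (fun e he => P.src_ne_sink he) θ
  rw [h]
  exact f.isTandem hN hτ P P.edges [] (by simp)

theorem sinkArrival_le_busyTime (hN : N.IsParallelPath) (hτ : ∀ e, N.transit e = 0) (P : N.Path)
    {b : ℝ} (hb : 0 ≤ b) : f.sinkArrival P b ≤ busyTime P.capacity (f.pathInflow P) b := by
  obtain ⟨s, hs, h⟩ := (f.isTandem_sinkArrival hN hτ P).upper P.capacity P.capacity_pos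
    (by rintro _ ⟨e, he, rfl⟩; exact P.exists_bottleneck.choose_spec.2 e he) b hb
  exact h.trans (le_busyTime P.capacity_pos (f.pathInflow_nonneg P) (f.pathInflow_integrable P) hs)

theorem integral_pathInflow_le (hN : N.IsParallelPath) (hτ : ∀ e, N.transit e = 0) (P : N.Path)
    {b : ℝ} (hb : 0 ≤ b) :
    ∫ ξ in (0 : ℝ)..b, f.pathInflow P ξ ≤ P.capacity * f.sinkArrival P b :=
  (f.isTandem_sinkArrival hN hτ P).lower _ ⟨_, P.exists_bottleneck.choose_spec.1, rfl⟩ b hb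

/-- Edges that enter the source carry no flow. -/
theorem ae_outflow_eq_zero (hτ : ∀ e, N.transit e = 0) {e : E} (he : N.tgt e = N.source) :
    ∀ᵐ θ ∂volume.restrict (Set.Ici (0 : ℝ)), N.outflow f.edgeInflow f.queue e θ = 0 := by
  -- A simple path never returns to the source, so no path induces flow on `e`.
  have hF : ∀ θ, 0 ≤ θ → ∫ ξ in (0 : ℝ)..θ, f.edgeInflow e ξ = 0 := by
    intro θ hθ
    rw [f.induced e θ hθ]
    refine Finset.sum_eq_zero fun P _ => ?_
    have : e ∉ P.edges := fun h => P.tgt_ne_source h he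
    simp [this]
  have hz : ∀ θ, 0 ≤ θ → f.queue e θ = 0 := by
    intro θ hθ
    obtain ⟨s, hs, h⟩ := (f.isQueue e).exists_busy_start (f.edgeInflow_integrable e) hθ
    have h1 := integral_add_of_zero (f.edgeInflow_integrable e) le_rfl hs.1 hθ
    rw [hF s hs.1, hF θ hθ, zero_add] at h1
    rw [h1] at h
    have := mul_nonneg (N.capacity_pos e).le (sub_nonneg.mpr hs.2)
    have := (f.isQueue e).nonneg θ hθ
    linarith
  have hfe : ∀ᵐ θ ∂volume.restrict (Set.Ici (0 : ℝ)), f.edgeInflow e θ = 0 := by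
    have hn : ∀ n : ℕ, ∀ᵐ θ ∂volume.restrict (Set.Ioc (0 : ℝ) n), f.edgeInflow e θ = 0 := by
      intro n
      have hn0 : (0 : ℝ) ≤ n := n.cast_nonneg
      have h := hF n hn0
      rw [intervalIntegral.integral_of_le hn0] at h
      exact (setIntegral_eq_zero_iff_of_nonneg_ae (ae_restrict_of_forall_mem measurableSet_Ioc
        fun θ hθ => f.edgeInflow_nonneg e θ hθ.1.le)
        ((intervalIntegrable_iff_integrableOn_Ioc_of_le hn0).mp
          (f.edgeInflow_integrable e n hn0))).mp h
    have hU : Set.Ioi (0 : ℝ) = ⋃ n : ℕ, Set.Ioc (0 : ℝ) n := by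
      ext x
      simp only [Set.mem_Ioi, Set.mem_iUnion, Set.mem_Ioc]
      exact ⟨fun hx => (exists_nat_ge x).imp fun n hn => ⟨hx, hn⟩, fun ⟨n, hn⟩ => hn.1⟩
    rw [← restrict_Ioi_eq_restrict_Ici, hU, ae_restrict_iUnion_iff]
    exact hn
  filter_upwards [hfe, ae_restrict_mem measurableSet_Ici] with θ h1 h2
  have h2 : 0 ≤ θ := h2
  simp [outflow, hτ, h1, hz θ h2, (N.capacity_pos e).le, not_lt.mpr h2]

open Classical in
/-- The path inflow rates add up to the network inflow rate. -/
theorem sum_integral_pathInflow (hτ : ∀ e, N.transit e = 0) {b : ℝ} (hb : 0 ≤ b) :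
    ∑ P : N.Path, ∫ ξ in (0 : ℝ)..b, f.pathInflow P ξ = N.inflow * b := by
  have hcons := f.conservation N.source N.source_ne_sink
  have hout : ∀ᵐ θ ∂volume.restrict (Set.Ici (0 : ℝ)),
      ∀ e, N.tgt e = N.source → N.outflow f.edgeInflow f.queue e θ = 0 := by
    rw [eventually_countable_forall]
    intro e
    by_cases he : N.tgt e = N.source
    · filter_upwards [f.ae_outflow_eq_zero hτ he] with θ hθ _ using hθ
    · exact .of_forall fun θ h => absurd h he
  have hsum : ∀ᵐ θ ∂volume.restrict (Set.Ici (0 : ℝ)),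
      ∑ e with N.src e = N.source, f.edgeInflow e θ = N.inflow := by
    filter_upwards [hcons, hout] with θ h1 h2
    rw [if_pos rfl, Finset.sum_eq_zero (s := Finset.univ.filter fun e => N.tgt e = N.source)
      (fun e he => h2 e (Finset.mem_filter.mp he).2), sub_zero] at h1
    exact h1
  have hint : ∫ ξ in (0 : ℝ)..b, ∑ e with N.src e = N.source, f.edgeInflow e ξ =
      N.inflow * b := by
    rw [intervalIntegral.integral_of_le hb, integral_congr_ae (ae_restrict_of_ae_restrict_of_subset
      (fun x hx => hx.1.le : Set.Ioc 0 b ⊆ Set.Ici 0) hsum)]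
    simp [hb, mul_comm]
  -- Each path has exactly one edge that leaves the source, and its particles enter that edge when
  -- they start.
  rw [← hint, intervalIntegral.integral_finsetSum fun e _ => f.edgeInflow_integrable e b hb,
    Finset.sum_congr rfl (fun e _ => f.induced e b hb), Finset.sum_comm]
  refine Finset.sum_congr rfl fun P _ => ?_
  obtain ⟨e₀, he₀, hs₀⟩ := P.exists_src_eq_source
  rw [Finset.sum_eq_single e₀]
  · have harr : ∀ ξ, N.arrival f.queue P (N.src e₀) ξ = ξ := by
      intro ξ
      have hw := P.2.1
      change N.IsWalk N.source P.edges N.sink at hw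
      rw [arrival]
      cases hp : P.edges with
      | nil => rfl
      | cons e p =>
        rw [hp] at hw
        rw [arrivalAlong, if_pos (hw.1.trans hs₀.symm)]
    have : {ξ | e₀ ∈ P.edges ∧ 0 ≤ ξ ∧ N.arrival f.queue P (N.src e₀) ξ ≤ b} = Set.Icc 0 b := by
      ext ξ; simp [he₀, harr]
    rw [this, integral_Icc_eq_integral_Ioc, ← intervalIntegral.integral_of_le hb]
  · intro e he hne
    have : e ∉ P.edges := fun h => hne
      (P.src_injective h he₀ ((Finset.mem_filter.mp he).2.trans hs₀.symm))
    simp [this]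
  · intro h
    simp [hs₀] at h

theorem lintegral_pathInflow (P : N.Path) {b : ℝ} (hb : 0 ≤ b) :
    ∫⁻ θ in Set.Icc 0 b, ENNReal.ofReal (f.pathInflow P θ) =
      ENNReal.ofReal (∫ ξ in (0 : ℝ)..b, f.pathInflow P ξ) := by
  rw [intervalIntegral.integral_of_le hb, ← integral_Icc_eq_integral_Ioc,
    ofReal_integral_eq_lintegral_ofReal]
  · exact (integrableOn_Icc_iff_integrableOn_Ioc).mpr
      ((intervalIntegrable_iff_integrableOn_Ioc_of_le hb).mp (f.pathInflow_integrable P b hb))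
  · exact ae_restrict_of_forall_mem measurableSet_Icc fun θ hθ => f.pathInflow_nonneg P θ hθ.1

/-- Particles that arrive in time start before `D`, which gives `u * D`; a bottleneck passes at most
its capacity times `D`, which gives the other bound. -/
theorem throughput_le (hN : N.IsParallelPath) (hτ : ∀ e, N.transit e = 0) :
    f.throughput ≤
      ENNReal.ofReal (min N.inflow (∑ P : N.Path, P.capacity) * N.deadline) := by
  have hD := N.deadline_pos
  have hbound : ∀ P : N.Path, ∃ b ∈ Set.Icc 0 N.deadline,
      (∫⁻ θ in {θ | 0 ≤ θ ∧ f.sinkArrival P θ < N.deadline}, ENNReal.ofReal (f.pathInflow P θ)) ≤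
        ENNReal.ofReal (∫ ξ in (0 : ℝ)..b, f.pathInflow P ξ) ∧
      f.sinkArrival P b ≤ N.deadline := by
    intro P
    have ht := f.isTandem_sinkArrival hN hτ P
    have hcomp : IsCompact (Set.Icc 0 N.deadline ∩ f.sinkArrival P ⁻¹' Set.Iic N.deadline) :=
      isCompact_Icc.of_isClosed_subset ((ht.continuousOn.mono fun x hx =>
        hx.1).preimage_isClosed_of_isClosed isClosed_Icc isClosed_Iic) Set.inter_subset_left
    obtain ⟨b, ⟨hb, hbD⟩, hmax⟩ :=
      hcomp.exists_isGreatest ⟨0, ⟨le_rfl, hD.le⟩, by simpa [ht.zero] using hD.le⟩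
    refine ⟨b, hb, ?_, hbD⟩
    rw [← f.lintegral_pathInflow P hb.1]
    exact lintegral_mono_set fun θ hθ =>
      ⟨hθ.1, hmax ⟨⟨hθ.1, (ht.le θ hθ.1).trans hθ.2.le⟩, hθ.2.le⟩⟩
  choose b hb hle hbD using hbound
  have hsum : f.throughput ≤ ENNReal.ofReal (∑ P : N.Path, ∫ ξ in (0 : ℝ)..b P, f.pathInflow P ξ) := by
    rw [ENNReal.ofReal_sum_of_nonneg fun P _ =>
      integral_nonneg_of_nonneg (f.pathInflow_nonneg P) le_rfl (hb P).1]
    exact Finset.sum_le_sum fun P _ => hle P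
  refine hsum.trans (ENNReal.ofReal_le_ofReal ?_)
  rw [min_mul_of_nonneg _ _ hD.le]
  refine le_min ?_ ?_
  · rw [← f.sum_integral_pathInflow hτ hD.le]
    refine Finset.sum_le_sum fun P _ => ?_
    rw [← integral_add_of_zero (f.pathInflow_integrable P) le_rfl (hb P).1 hD.le]
    exact le_add_of_nonneg_right (integral_nonneg_of_nonneg (f.pathInflow_nonneg P) (hb P).1
      (hb P).2)
  · rw [Finset.sum_mul]
    exact Finset.sum_le_sum fun P _ => (f.integral_pathInflow_le hN hτ P (hb P).1).trans
      (mul_le_mul_of_nonneg_left (hbD P) P.capacity_pos.le)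

/-- Before time `b` some path has finite cost, so almost all flow that starts before `b` takes a
path that meets the deadline. -/
theorem IsNash.le_throughput {f : FlowOverTime N} (hf : f.IsNash) (hN : N.IsParallelPath)
    (hτ : ∀ e, N.transit e = 0) :
    ENNReal.ofReal (N.inflow * (N.deadline *
      (1 - Real.exp (-((∑ P : N.Path, P.capacity) / N.inflow))))) ≤ f.throughput := by
  set b := N.deadline * (1 - Real.exp (-((∑ P : N.Path, P.capacity) / N.inflow))) with hbdef
  have hS : 0 ≤ (∑ P : N.Path, P.capacity) / N.inflow :=
    div_nonneg (Finset.sum_nonneg fun P _ => P.capacity_pos.le) N.inflow_pos.le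
  have hb : 0 ≤ b := mul_nonneg N.deadline_pos.le
    (sub_nonneg.mpr (Real.exp_le_one_iff.mpr (by linarith)))
  rw [← f.sum_integral_pathInflow hτ hb, ENNReal.ofReal_sum_of_nonneg fun P _ =>
      integral_nonneg_of_nonneg (f.pathInflow_nonneg P) le_rfl hb]
  refine Finset.sum_le_sum fun P _ => ?_
  -- `exists_busyTime_lt` needs a time strictly before `b`; the endpoint is a null set.
  rw [← f.lintegral_pathInflow P hb, ← restrict_Ico_eq_restrict_Icc]
  have hmeas : MeasurableSet {θ | 0 ≤ θ ∧ f.sinkArrival P θ < N.deadline} := by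
    obtain ⟨U, hU, hU'⟩ := (continuousOn_iff'.mp
      (f.isTandem_sinkArrival hN hτ P).continuousOn) (Set.Iio N.deadline) isOpen_Iio
    have : {θ | 0 ≤ θ ∧ f.sinkArrival P θ < N.deadline} = U ∩ Set.Ici 0 := by
      rw [← hU']; ext θ; simp [and_comm]
    rw [this]
    exact hU.measurableSet.inter measurableSet_Ici
  rw [← lintegral_inter_add_sdiff _ (Set.Ico 0 b) hmeas]
  have hzero : ∫⁻ θ in Set.Ico 0 b \ {θ | 0 ≤ θ ∧ f.sinkArrival P θ < N.deadline},
      ENNReal.ofReal (f.pathInflow P θ) = 0 := by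
    rw [← lintegral_zero (μ := volume.restrict (Set.Ico 0 b \ {θ | 0 ≤ θ ∧
      f.sinkArrival P θ < N.deadline}))]
    refine lintegral_congr_ae ?_
    filter_upwards [ae_restrict_of_ae_restrict_of_subset (fun x hx => hx.1.1 :
      Set.Ico 0 b \ {θ | 0 ≤ θ ∧ f.sinkArrival P θ < N.deadline} ⊆ Set.Ici 0) hf,
      ae_restrict_mem (measurableSet_Ico.diff hmeas)] with θ h1 h2
    refine ENNReal.ofReal_eq_zero.mpr (not_lt.mp fun hpos => ?_)
    obtain ⟨Q, hQ⟩ := exists_busyTime_lt (fun P : N.Path => P.capacity_pos) f.pathInflow_nonneg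
      f.pathInflow_integrable N.inflow_pos N.deadline_pos
      (fun b hb => f.sum_integral_pathInflow hτ hb) h2.1.1 h2.1.2
    have hQD := (f.sinkArrival_le_busyTime hN hτ Q h2.1.1).trans_lt hQ
    have hPD : ¬ f.sinkArrival P θ < N.deadline := fun h => h2.2 ⟨h2.1.1, h⟩
    have := h1 P hpos Q
    rw [particleCost, particleCost, if_neg hPD, if_pos hQD] at this
    exact absurd (top_le_iff.mp this) ENNReal.coe_ne_top
  rw [hzero, add_zero]
  exact lintegral_mono_set Set.inter_subset_right

end FlowOverTime

/-- On `[0, 1]` the concave function `1 - exp (-x)` lies above its chord, whose slope is `(e - 1) /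
e`; beyond `1` monotonicity suffices. -/
theorem min_one_le_mul_one_sub_exp {x : ℝ} (hx : 0 ≤ x) :
    min 1 x ≤ Real.exp 1 / (Real.exp 1 - 1) * (1 - Real.exp (-x)) := by
  have he : 1 < Real.exp 1 := Real.one_lt_exp_iff.mpr one_pos
  have hinv : Real.exp 1 * Real.exp (-1) = 1 := by rw [← Real.exp_add]; simp
  rw [div_mul_eq_mul_div, le_div_iff₀ (by linarith)]
  rcases le_total 1 x with h | h
  · rw [min_eq_left h]
    have := mul_le_mul_of_nonneg_left (Real.exp_le_exp.mpr (neg_le_neg h)) (Real.exp_pos 1).le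
    linarith
  · rw [min_eq_right h]
    have hconv := convexOn_exp.2 (Set.mem_univ 0) (Set.mem_univ (-1 : ℝ)) (sub_nonneg.mpr h) hx
      (by ring)
    simp only [smul_eq_mul, mul_zero, mul_neg, mul_one, zero_add, Real.exp_zero] at hconv
    have := mul_le_mul_of_nonneg_left hconv (Real.exp_pos 1).le
    have h2 : Real.exp 1 * (1 - x + x * Real.exp (-1)) = Real.exp 1 - Real.exp 1 * x + x := by
      linear_combination x * hinv
    linarith

theorem throughputPoA_le [Fintype E] (hN : N.IsParallelPath) (hτ : ∀ e, N.transit e = 0) :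
    N.throughputPoA ≤ ENNReal.ofReal (Real.exp 1 / (Real.exp 1 - 1)) := by
  refine iSup₂_le fun f hf => ENNReal.div_le_of_le_mul ?_
  refine (iSup_le fun g => g.throughput_le hN hτ).trans
    (le_trans ?_ (mul_le_mul_right (hf.le_throughput hN hτ) _))
  have he : 1 < Real.exp 1 := Real.one_lt_exp_iff.mpr one_pos
  rw [← ENNReal.ofReal_mul (div_nonneg (Real.exp_pos 1).le (by linarith))]
  refine ENNReal.ofReal_le_ofReal ?_
  set S := ∑ P : N.Path, P.capacity
  have hS : 0 ≤ S / N.inflow :=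
    div_nonneg (Finset.sum_nonneg fun P _ => P.capacity_pos.le) N.inflow_pos.le
  have h := mul_le_mul_of_nonneg_left (min_one_le_mul_one_sub_exp hS)
    (mul_nonneg N.inflow_pos.le N.deadline_pos.le)
  have e : min N.inflow S = N.inflow * min 1 (S / N.inflow) := by
    rw [mul_min_of_nonneg _ _ N.inflow_pos.le, mul_one, mul_div_cancel₀ _ N.inflow_pos.ne']
  rw [e]
  linarith

end Network
-- Uniform parallel links.
namespace Network

namespace uniformLinks

variable {k : ℕ} {c : Fin k → ℝ≥0}

theorem isPath_iff {p : List (Fin k)} : (uniformLinks k c).IsPath p ↔ ∃ e, p = [e] := by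
  constructor
  · rintro ⟨hw, -⟩
    match p, hw with
    | [], h => exact absurd h Bool.false_ne_true
    | [e], _ => exact ⟨e, rfl⟩
    | _ :: _ :: _, h => exact absurd h.2.1 Bool.false_ne_true
  · rintro ⟨e, rfl⟩
    exact ⟨⟨rfl, rfl⟩, by simp [uniformLinks]⟩

/-- The path that consists of a single link. -/
def linkPath (c : Fin k → ℝ≥0) (e : Fin k) : (uniformLinks k c).Path :=
  ⟨[e], isPath_iff.mpr ⟨e, rfl⟩⟩

theorem bijective_linkPath (c : Fin k → ℝ≥0) : Function.Bijective (linkPath c) := by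
  constructor
  · intro e e' h
    have : [e] = [e'] := congrArg Subtype.val h
    simpa using this
  · rintro ⟨p, hp⟩
    obtain ⟨e, rfl⟩ := isPath_iff.mp hp
    exact ⟨e, rfl⟩

/-- The paths correspond to the links. -/
noncomputable def linkEquiv (c : Fin k → ℝ≥0) : Fin k ≃ (uniformLinks k c).Path :=
  Equiv.ofBijective _ (bijective_linkPath c)

theorem edges_linkEquiv (e : Fin k) : (linkEquiv c e).edges = [e] := rfl

theorem isParallelPath (c : Fin k → ℝ≥0) : (uniformLinks k c).IsParallelPath := by
  intro P Q hPQ e heP heQ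
  obtain ⟨a, rfl⟩ := (linkEquiv c).surjective P
  obtain ⟨b, rfl⟩ := (linkEquiv c).surjective Q
  rw [edges_linkEquiv, List.mem_singleton] at heP heQ
  exact hPQ (by rw [← heP, ← heQ])

/-- The flow over time with given link inflow rates and queues. -/
noncomputable def flow (c : Fin k → ℝ≥0) (r z : Fin k → ℝ → ℝ)
    (hr : ∀ e θ, 0 ≤ θ → 0 ≤ r e θ)
    (hri : ∀ e θ, 0 ≤ θ → IntervalIntegrable (r e) volume 0 θ)
    (hq : ∀ e, IsQueue (1 / k) (r e) (z e))
    (hsum : ∀ θ, 0 ≤ θ → ∑ e, r e θ = 1) : FlowOverTime (uniformLinks k c) where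
  pathInflow P := r ((linkEquiv c).symm P)
  edgeInflow := r
  queue := z
  pathInflow_nonneg _ := hr _
  pathInflow_integrable _ := hri _
  edgeInflow_nonneg := hr
  edgeInflow_integrable := hri
  isQueue := hq
  conservation v hv := by
    cases v with
    | true => exact absurd rfl hv
    | false =>
      filter_upwards [ae_restrict_mem measurableSet_Ici] with θ hθ
      simpa [uniformLinks] using hsum θ hθ
  induced e θ hθ := by
    rw [← (linkEquiv c).sum_comp, Finset.sum_eq_single e]
    · have : {ξ | e ∈ (linkEquiv c e).edges ∧ 0 ≤ ξ ∧ (uniformLinks k c).arrival z (linkEquiv c e)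
          ((uniformLinks k c).src e) ξ ≤ θ} = Set.Icc 0 θ := by
        ext ξ
        simp [edges_linkEquiv, arrival, arrivalAlong]
      rw [this, integral_Icc_eq_integral_Ioc, ← intervalIntegral.integral_of_le hθ,
        Equiv.symm_apply_apply]
    · intro e' _ he'
      simp [edges_linkEquiv, he'.symm]
    · simp

theorem sinkArrival_eq (f : FlowOverTime (uniformLinks k c)) (e : Fin k) (θ : ℝ) :
    f.sinkArrival (linkEquiv c e) θ = θ + f.queue e θ * k := by
  rw [FlowOverTime.sinkArrival, arrival, edges_linkEquiv]
  simp [arrivalAlong, exitTime, uniformLinks]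

theorem cost_linkEquiv (e : Fin k) : (linkEquiv c e).cost = c e := by
  rw [Path.cost, edges_linkEquiv]
  simp [uniformLinks]

/-- Splitting the inflow evenly keeps all queues empty, so every particle that starts before time
`1` arrives in time. -/
theorem one_le_optThroughput (hk : 0 < k) (c : Fin k → ℝ≥0) :
    1 ≤ (uniformLinks k c).optThroughput := by
  have hk' : (k : ℝ) ≠ 0 := by positivity
  let f : FlowOverTime (uniformLinks k c) := flow c (fun _ _ => 1 / k) (fun _ _ => 0)
    (fun _ _ _ => by positivity) (fun _ _ _ => intervalIntegrable_const)
    (fun _ => ⟨fun _ _ => le_rfl, continuousOn_const, fun _ _ => by simp⟩)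
    (fun _ _ => by simp [hk'])
  refine le_trans ?_ (le_iSup _ f)
  have hset : ∀ P, {θ | 0 ≤ θ ∧ f.sinkArrival P θ < (uniformLinks k c).deadline} =
      Set.Ico 0 1 := by
    intro P
    obtain ⟨e, rfl⟩ := (linkEquiv c).surjective P
    ext θ
    rw [Set.mem_ofPred_eq, sinkArrival_eq]
    simp [f, flow, uniformLinks]
  have h := f.sum_integral_pathInflow (fun _ => rfl) zero_le_one
  rw [FlowOverTime.throughput]
  simp_rw [hset, restrict_Ico_eq_restrict_Icc, f.lintegral_pathInflow _ zero_le_one]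
  rw [← ENNReal.ofReal_sum_of_nonneg fun P _ =>
    integral_nonneg_of_nonneg (f.pathInflow_nonneg P) le_rfl zero_le_one, h]
  simp [uniformLinks]

end uniformLinks

/-! ### Filling a link by a burst. -/

/-- The unit step at `a`. -/
noncomputable def unitStep (a θ : ℝ) : ℝ := if a ≤ θ then 1 else 0

theorem unitStep_eq_indicator (a : ℝ) : unitStep a = (Set.Ici a).indicator fun _ => 1 := by
  ext θ
  simp [unitStep, Set.indicator]

theorem intervalIntegrable_unitStep (a x y : ℝ) :
    IntervalIntegrable (unitStep a) volume x y := by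
  rw [unitStep_eq_indicator]
  exact intervalIntegrable_iff.mpr ((integrableOn_const (by simp)).indicator measurableSet_Ici)

theorem integral_unitStep {a θ : ℝ} (ha : 0 ≤ a) (hθ : 0 ≤ θ) :
    ∫ ξ in (0 : ℝ)..θ, unitStep a ξ = max (θ - a) 0 := by
  rcases le_total a θ with h | h
  · rw [max_eq_left (by linarith), ← intervalIntegral.integral_add_adjacent_intervals
      (intervalIntegrable_unitStep a 0 a) (intervalIntegrable_unitStep a a θ)]
    have h1 : ∫ ξ in (0 : ℝ)..a, unitStep a ξ = ∫ ξ in (0 : ℝ)..a, (0 : ℝ) := by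
      refine intervalIntegral.integral_congr_ae ?_
      filter_upwards [Measure.ae_ne volume a] with ξ hne hξ
      rw [Set.uIoc_of_le ha] at hξ
      exact if_neg (not_le.mpr (lt_of_le_of_ne hξ.2 hne))
    have h2 : ∫ ξ in a..θ, unitStep a ξ = ∫ ξ in a..θ, (1 : ℝ) := by
      refine intervalIntegral.integral_congr fun ξ hξ => ?_
      rw [Set.uIcc_of_le h] at hξ
      exact if_pos hξ.1
    rw [h1, h2]
    simp
  · rw [max_eq_right (by linarith)]
    have h1 : ∫ ξ in (0 : ℝ)..θ, unitStep a ξ = ∫ ξ in (0 : ℝ)..θ, (0 : ℝ) := by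
      refine intervalIntegral.integral_congr_ae ?_
      filter_upwards [Measure.ae_ne volume a] with ξ hne hξ
      rw [Set.uIoc_of_le hθ] at hξ
      exact if_neg (not_le.mpr (lt_of_le_of_ne (hξ.2.trans h) hne))
    rw [h1]
    simp

/-- The inflow rate of a link of capacity `ν` that receives the whole flow during `[a, b)` and its
share after time `d`. -/
noncomputable def burstRate (ν a b d θ : ℝ) : ℝ := unitStep a θ - unitStep b θ + ν * unitStep d θ

/-- The queue that results from `burstRate`. -/
noncomputable def burstQueue (ν a b d θ : ℝ) : ℝ :=
  (1 - ν) * max (θ - a) 0 - max (θ - b) 0 + ν * max (θ - d) 0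

section burst

variable {ν a b d : ℝ}

theorem burstRate_nonneg (hν : 0 ≤ ν) (hab : a ≤ b) (θ : ℝ) : 0 ≤ burstRate ν a b d θ := by
  simp only [burstRate, unitStep]
  split_ifs <;> linarith

theorem intervalIntegrable_burstRate (x y : ℝ) :
    IntervalIntegrable (burstRate ν a b d) volume x y :=
  ((intervalIntegrable_unitStep a x y).sub (intervalIntegrable_unitStep b x y)).add
    ((intervalIntegrable_unitStep d x y).const_mul ν)

theorem burstQueue_of_lt {θ : ℝ} (hbd : b ≤ d) (h : θ < b) :
    burstQueue ν a b d θ = (1 - ν) * max (θ - a) 0 := by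
  rw [burstQueue, max_eq_right (by linarith : θ - b ≤ 0), max_eq_right (by linarith : θ - d ≤ 0)]
  ring

/-- `heq` says that a particle entering at `b` exits exactly at time `1`. The queue then drains at
rate `ν`, which keeps the exit time at `1` until `d`; from `d` on, inflow `ν` freezes the queue. -/
theorem burstQueue_of_ge {θ : ℝ} (hab : a ≤ b) (heq : 1 - b = (1 - ν) * (1 - a)) (h : b ≤ θ) :
    burstQueue ν a b d θ = ν * (1 - θ + max (θ - d) 0) := by
  rw [burstQueue, max_eq_left (by linarith : 0 ≤ θ - b), max_eq_left (by linarith : 0 ≤ θ - a)]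
  linear_combination -heq

theorem lt_add_max_sub {θ : ℝ} (hd : d < 1) : 0 < 1 - θ + max (θ - d) 0 := by
  linarith [le_max_left (θ - d) 0]

theorem isQueue_burst (hν : 0 < ν) (hν1 : ν < 1) (ha : 0 ≤ a) (hab : a < b) (hbd : b ≤ d)
    (hd : d < 1) (heq : 1 - b = (1 - ν) * (1 - a)) :
    IsQueue ν (burstRate ν a b d) (burstQueue ν a b d) where
  nonneg θ hθ := by
    rcases lt_or_ge θ b with h | h
    · rw [burstQueue_of_lt hbd h]
      exact mul_nonneg (by linarith) (le_max_right _ _)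
    · rw [burstQueue_of_ge hab.le heq h]
      exact mul_nonneg hν.le (lt_add_max_sub hd).le
  continuousOn := by unfold burstQueue; fun_prop
  dynamics θ hθ := by
    -- The queue never empties after `a`, because draining stops at `d < 1`. At `ξ = a` it is still
    -- empty, but the rate `1 - ν` is positive, so both branches agree.
    have hrate : ∀ ξ, (if 0 < burstQueue ν a b d ξ then burstRate ν a b d ξ - ν
        else max (burstRate ν a b d ξ - ν) 0) =
        (1 - ν) * unitStep a ξ - unitStep b ξ + ν * unitStep d ξ := by
      intro ξ
      rcases lt_or_ge ξ b with h | h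
      · have hb : unitStep b ξ = 0 := if_neg (not_le.mpr h)
        have hd' : unitStep d ξ = 0 := if_neg (not_le.mpr (h.trans_le hbd))
        rw [burstQueue_of_lt hbd h, burstRate, hb, hd']
        rcases lt_or_ge ξ a with h' | h'
        · have : unitStep a ξ = 0 := if_neg (not_le.mpr h')
          rw [max_eq_right (by linarith), this]
          simp [hν.le]
        · have : unitStep a ξ = 1 := if_pos h'
          rw [this]
          simp [hν1.le]
      · have hb : unitStep b ξ = 1 := if_pos h
        have ha : unitStep a ξ = 1 := if_pos (hab.le.trans h)
        rw [burstQueue_of_ge hab.le heq h, if_pos (mul_pos hν (lt_add_max_sub hd)), burstRate, ha,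
          hb]
        ring
    have ia := intervalIntegrable_unitStep a 0 θ
    have ib := intervalIntegrable_unitStep b 0 θ
    have id' := intervalIntegrable_unitStep d 0 θ
    simp_rw [hrate]
    rw [intervalIntegral.integral_add ((ia.const_mul _).sub ib) (id'.const_mul _),
      intervalIntegral.integral_sub (ia.const_mul _) ib, intervalIntegral.integral_const_mul,
      intervalIntegral.integral_const_mul, integral_unitStep ha hθ,
      integral_unitStep (ha.trans hab.le) hθ, integral_unitStep (ha.trans (hab.le.trans hbd)) hθ,
      burstQueue]

theorem exit_burst_lt_one_iff (hν : 0 < ν) (hab : a < b) (hbd : b ≤ d) (hd : d < 1)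
    (heq : 1 - b = (1 - ν) * (1 - a)) (θ : ℝ) :
    θ + burstQueue ν a b d θ / ν < 1 ↔ θ < b := by
  rw [← lt_sub_iff_add_lt', div_lt_iff₀ hν]
  rcases lt_or_ge θ b with h | h
  · rw [burstQueue_of_lt hbd h]
    refine iff_of_true ?_ h
    rcases le_total θ a with h' | h'
    · rw [max_eq_right (by linarith)]; nlinarith
    · rw [max_eq_left (by linarith)]; nlinarith
  · rw [burstQueue_of_ge hab.le heq h]
    refine iff_of_false ?_ (not_lt.mpr h)
    nlinarith [le_max_right (θ - d) 0]

end burst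

/-! ### The sequential Nash flow and the limit. -/

/-- The time at which the `j` cheapest of `k` uniform links are saturated. -/
noncomputable def saturationTime (k j : ℕ) : ℝ := 1 - (1 - 1 / (k : ℝ)) ^ j

section saturationTime

variable {k : ℕ}

theorem one_sub_inv_mem_Ioo (hk : 2 ≤ k) : 1 - 1 / (k : ℝ) ∈ Set.Ioo (0 : ℝ) 1 := by
  have h2 : (2 : ℝ) ≤ k := by exact_mod_cast hk
  have h1 : 1 / (k : ℝ) < 1 := by rw [div_lt_one (by linarith)]; linarith
  have h0 : 0 < 1 / (k : ℝ) := by positivity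
  constructor <;> linarith

theorem strictMono_saturationTime (hk : 2 ≤ k) : StrictMono (saturationTime k) := by
  obtain ⟨h0, h1⟩ := one_sub_inv_mem_Ioo hk
  intro i j hij
  exact sub_lt_sub_left (pow_lt_pow_right_of_lt_one₀ h0 h1 hij) 1

theorem saturationTime_zero : saturationTime k 0 = 0 := by simp [saturationTime]

theorem saturationTime_lt_one (hk : 2 ≤ k) (j : ℕ) : saturationTime k j < 1 := by
  have := pow_pos (one_sub_inv_mem_Ioo hk).1 j
  rw [saturationTime]
  linarith

theorem one_sub_saturationTime_succ (j : ℕ) :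
    1 - saturationTime k (j + 1) = (1 - 1 / (k : ℝ)) * (1 - saturationTime k j) := by
  simp only [saturationTime]
  ring

end saturationTime

namespace uniformLinks

variable {k : ℕ}

/-- The bursts telescope to `1` minus the step at `saturationTime k k`, and the `k` shares `1/k`
restore that step. -/
theorem sum_burstRate (hk : 2 ≤ k) (σ : Equiv.Perm (Fin k)) {θ : ℝ} (hθ : 0 ≤ θ) :
    ∑ e, burstRate (1 / k) (saturationTime k (σ.symm e)) (saturationTime k (σ.symm e + 1))
      (saturationTime k k) θ = 1 := by
  rw [σ.symm.sum_comp fun j : Fin k => burstRate (1 / k) (saturationTime k j)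
    (saturationTime k (j + 1)) (saturationTime k k) θ,
    Fin.sum_univ_eq_sum_range fun j : ℕ => burstRate (1 / k) (saturationTime k j)
    (saturationTime k (j + 1)) (saturationTime k k) θ]
  simp only [burstRate]
  rw [Finset.sum_add_distrib, Finset.sum_range_sub' fun j => unitStep (saturationTime k j) θ]
  have hk' : (k : ℝ) ≠ 0 := by positivity
  have h0 : unitStep (saturationTime k 0) θ = 1 := if_pos (by rwa [saturationTime_zero])
  rw [h0, Finset.sum_const, Finset.card_range, nsmul_eq_mul]
  field_simp
  ring

/-- The Nash flow in which the links are saturated one after the other. -/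
noncomputable def nashFlow (hk : 2 ≤ k) (c : Fin k → ℝ≥0) : FlowOverTime (uniformLinks k c) :=
  flow c
    (fun e => burstRate (1 / k) (saturationTime k ((Tuple.sort c).symm e))
      (saturationTime k ((Tuple.sort c).symm e + 1)) (saturationTime k k))
    (fun e => burstQueue (1 / k) (saturationTime k ((Tuple.sort c).symm e))
      (saturationTime k ((Tuple.sort c).symm e + 1)) (saturationTime k k))
    (fun _ θ _ => burstRate_nonneg (by positivity)
      ((strictMono_saturationTime hk).monotone (Nat.le_succ _)) θ)
    (fun _ _ _ => intervalIntegrable_burstRate _ _)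
    (fun e => isQueue_burst (by positivity) (by linarith [(one_sub_inv_mem_Ioo hk).1])
      (by rw [← saturationTime_zero (k := k)]
          exact (strictMono_saturationTime hk).monotone (Nat.zero_le _))
      (strictMono_saturationTime hk (Nat.lt_succ_self _))
      ((strictMono_saturationTime hk).monotone (Fin.is_lt _)) (saturationTime_lt_one hk k)
      (one_sub_saturationTime_succ _))
    (fun _ hθ => sum_burstRate hk _ hθ)

theorem nashFlow_sinkArrival_lt_iff (hk : 2 ≤ k) (c : Fin k → ℝ≥0) (e : Fin k) (θ : ℝ) :
    (nashFlow hk c).sinkArrival (linkEquiv c e) θ < (uniformLinks k c).deadline ↔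
      θ < saturationTime k ((Tuple.sort c).symm e + 1) := by
  rw [← exit_burst_lt_one_iff (ν := 1 / k) (by positivity)
    (strictMono_saturationTime hk (Nat.lt_succ_self _))
    ((strictMono_saturationTime hk).monotone (Fin.is_lt _)) (saturationTime_lt_one hk k)
    (one_sub_saturationTime_succ _), sinkArrival_eq, div_div_eq_mul_div, div_one]
  rfl

theorem isNash_nashFlow (hk : 2 ≤ k) (c : Fin k → ℝ≥0) : (nashFlow hk c).IsNash := by
  refine .of_forall fun θ P hP Q => ?_
  obtain ⟨e, rfl⟩ := (linkEquiv c).surjective P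
  obtain ⟨e', rfl⟩ := (linkEquiv c).surjective Q
  rw [FlowOverTime.particleCost, FlowOverTime.particleCost]
  simp only [nashFlow_sinkArrival_lt_iff, cost_linkEquiv]
  -- If `e'` still meets the deadline, then not all links are saturated, so flow on `e` must belong
  -- to its burst. Hence `e` meets the deadline and comes no later than `e'` in the cost order.
  by_cases h' : θ < saturationTime k ((Tuple.sort c).symm e' + 1)
  · have hd : θ < saturationTime k k :=
      h'.trans_le ((strictMono_saturationTime hk).monotone (Fin.is_lt _))
    have hP : 0 < burstRate (1 / k) (saturationTime k ((Tuple.sort c).symm e))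
        (saturationTime k ((Tuple.sort c).symm e + 1)) (saturationTime k k) θ := by
      simpa [nashFlow, flow] using hP
    have hd0 : unitStep (saturationTime k k) θ = 0 := if_neg (not_le.mpr hd)
    rw [burstRate, hd0, mul_zero, add_zero] at hP
    simp only [unitStep] at hP
    have h1 : saturationTime k ((Tuple.sort c).symm e) ≤ θ := by
      by_contra h
      rw [if_neg h] at hP
      split_ifs at hP <;> linarith
    have h2 : θ < saturationTime k ((Tuple.sort c).symm e + 1) := by
      by_contra h
      rw [if_pos (not_lt.mp h), if_pos h1] at hP
      linarith
    rw [if_pos h2, if_pos h']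
    have hlt := (strictMono_saturationTime hk).lt_iff_lt.mp (h1.trans_lt h')
    have hle : (Tuple.sort c).symm e ≤ (Tuple.sort c).symm e' := Nat.lt_succ_iff.mp hlt
    have := Tuple.monotone_sort c hle
    simpa using this
  · rw [if_neg h']
    exact le_top

theorem throughput_nashFlow_le (hk : 2 ≤ k) (c : Fin k → ℝ≥0) :
    (nashFlow hk c).throughput ≤ ENNReal.ofReal (saturationTime k k) := by
  have h0 : 0 ≤ saturationTime k k := by
    rw [← saturationTime_zero (k := k)]
    exact (strictMono_saturationTime hk).monotone (Nat.zero_le _)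
  have h := (nashFlow hk c).sum_integral_pathInflow (fun _ => rfl) h0
  have h1 : (uniformLinks k c).inflow = 1 := rfl
  rw [h1, one_mul] at h
  rw [← h, ENNReal.ofReal_sum_of_nonneg fun P _ =>
    integral_nonneg_of_nonneg ((nashFlow hk c).pathInflow_nonneg P) le_rfl h0]
  refine Finset.sum_le_sum fun P _ => ?_
  rw [← (nashFlow hk c).lintegral_pathInflow P h0]
  refine lintegral_mono_set fun θ hθ => ⟨hθ.1, ?_⟩
  obtain ⟨e, rfl⟩ := (linkEquiv c).surjective P
  exact ((nashFlow_sinkArrival_lt_iff hk c e θ).mp hθ.2).le.trans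
    ((strictMono_saturationTime hk).monotone (Fin.is_lt _))

theorem le_throughputPoA (hk : 2 ≤ k) (c : Fin k → ℝ≥0) :
    ENNReal.ofReal (1 / (1 - (1 - 1 / (k : ℝ)) ^ k)) ≤ (uniformLinks k c).throughputPoA := by
  refine le_trans ?_ (le_iSup₂ (nashFlow hk c) (isNash_nashFlow hk c))
  have hpos : 0 < saturationTime k k := by
    rw [← saturationTime_zero (k := k)]
    exact strictMono_saturationTime hk (by omega)
  change ENNReal.ofReal (1 / saturationTime k k) ≤ _
  rw [ENNReal.ofReal_div_of_pos hpos, ENNReal.ofReal_one]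
  exact ENNReal.div_le_div (one_le_optThroughput (by omega) c) (throughput_nashFlow_le hk c)

theorem tendsto_throughputPoA (c : (k : ℕ) → Fin k → ℝ≥0) :
    Tendsto (fun k => (uniformLinks k (c k)).throughputPoA) atTop
      (𝓝 (ENNReal.ofReal (Real.exp 1 / (Real.exp 1 - 1)))) := by
  have he : 1 < Real.exp 1 := Real.one_lt_exp_iff.mpr one_pos
  have hlim : Tendsto (fun k : ℕ => 1 / (1 - (1 - 1 / (k : ℝ)) ^ k)) atTop
      (𝓝 (Real.exp 1 / (Real.exp 1 - 1))) := by
    have h := Real.tendsto_one_add_div_pow_exp (-1)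
    have h' : Tendsto (fun k : ℕ => (1 - 1 / (k : ℝ)) ^ k) atTop (𝓝 (Real.exp (-1))) := by
      refine h.congr fun k => ?_
      rw [neg_div, ← sub_eq_add_neg]
    have hne : 1 - Real.exp (-1) ≠ 0 := by
      have : Real.exp (-1) < 1 := Real.exp_lt_one_iff.mpr (by norm_num)
      linarith
    have e : Real.exp 1 / (Real.exp 1 - 1) = 1 / (1 - Real.exp (-1)) := by
      have h1 : Real.exp 1 - 1 ≠ 0 := by linarith
      rw [div_eq_div_iff h1 hne, mul_sub, ← Real.exp_add]
      simp
    rw [e]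
    exact tendsto_const_nhds.div (tendsto_const_nhds.sub h') hne
  refine tendsto_of_tendsto_of_tendsto_of_le_of_le' (ENNReal.tendsto_ofReal hlim)
    tendsto_const_nhds ?_ (.of_forall fun k => throughputPoA_le (isParallelPath (c k)) fun _ => rfl)
  -- For `k = 1` the factor `1 - 1/k` is zero and the saturation times are not strictly increasing.
  filter_upwards [eventually_ge_atTop 2] with k hk using le_throughputPoA hk (c k)

end uniformLinks

end Network

theorem mainTheorem3 :
    (∀ (V : Type*) (E : Type*) [Fintype E] (N : Network V E),
      N.IsParallelPath → (∀ e, N.transit e = 0) →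
        N.throughputPoA ≤ ENNReal.ofReal (Real.exp 1 / (Real.exp 1 - 1))) ∧
    (∀ c : (k : ℕ) → Fin k → ℝ≥0,
      (∀ k, (Network.uniformLinks k (c k)).IsParallelPath ∧
        ∀ e, (Network.uniformLinks k (c k)).transit e = 0) ∧
      Tendsto (fun k => (Network.uniformLinks k (c k)).throughputPoA) atTop
        (𝓝 (ENNReal.ofReal (Real.exp 1 / (Real.exp 1 - 1))))) :=
  ⟨fun _ _ _ _ hN hτ => Network.throughputPoA_le hN hτ, fun c =>
    ⟨fun k => ⟨Network.uniformLinks.isParallelPath (c k), fun _ => rfl⟩,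
      Network.uniformLinks.tendsto_throughputPoA c⟩⟩
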